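/- Let $\mathcal C$ be an additive category and let $m\ge 1$ and $n\ge 3$ be integers. Then $\mathcal C$ is both an $n$-angulated category and an $m$-abelian category if and only if $\mathcal C$ is semisimple. More precisely, this holds when "$n$-angulated" means that $(\mathcal C,\Sigma)$ admits an $n$-angulation for some automorphism $\Sigma$ of $\mathcal C$; and for each fixed automorphism $\Sigma$ of $\mathcal C$, the pair $(\mathcal C,\Sigma)$ admits an $n$-angulation and $\mathcal C$ is $m$-abelian if and only if $\mathcal C$ is semisimple. Here the following definitions are used. *Semisimple.* $\mathcal C$ is semisimple if each morphism $f$ factors as $f=hg$ with $g$ a split epimorphism and $h$ a split monomorphism. *$m$-abelian.* In a sequence $X^0\xrightarrow{d^0}X^1\to\cdots\xrightarrow{d^m}X^{m+1}$, $(d^1,\dots,d^m)$ is an $m$-cokernel of $d^0$ if for every object $Y$ the sequence $0\to\mathcal C(X^{m+1},Y)\to\mathcal C(X^m,Y)\to\cdots\to\mathcal C(X^0,Y)$ is exact; $(d^0,\dots,d^{m-1})$ is an $m$-kernel of $d^m$ if dually $0\to\mathcal C(Y,X^0)\to\cdots\to\mathcal C(Y,X^{m+1})$ is exact for every $Y$;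 the sequence is $m$-exact if both hold. $\mathcal C$ is $m$-abelian if it is idempotent complete, every morphism has an $m$-kernel and an $m$-cokernel, every monomorphism together with any of its $m$-cokernels forms an $m$-exact sequence, and every epimorphism together with any of its $m$-kernels forms an $m$-exact sequence. *$n$-angulated.* An $n$-$\Sigma$-sequence is a sequence of morphisms $X_1\xrightarrow{f_1}X_2\to\cdots\to X_n\xrightarrow{f_n}\Sigma X_1$; its left rotation is $X_2\xrightarrow{f_2}\cdots\xrightarrow{f_n}\Sigma X_1\xrightarrow{(-1)^n\Sigma f_1}\Sigma X_2$; a morphism $(X_\bullet,f_\bullet)\to(Y_\bullet,g_\bullet)$ is a family $\varphi_i:X_i\to Y_i$ $(1\le i\le n)$ that commutes with the $f_i$ and $g_i$, with $\Sigma\varphi_1$ on the last term, and an isomorphism if all $\varphi_i$ are isomorphisms. An $n$-angulation of $(\mathcal C,\Sigma)$ is a class $\Theta$ of $n$-$\Sigma$-sequences such that: (N1) $\Theta$ is closed under isomorphisms, direct sums and direct summands; it contains $X\xrightarrow{1}X\to0\to\cdots\to0\to\Sigma X$ for every object $X$; and every morphism of $\mathcal C$ is the first morphism $f_1$ of some element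 of $\Theta$; (N2) an $n$-$\Sigma$-sequence belongs to $\Theta$ if and only if its left rotation does; (N3) for $X_\bullet,Y_\bullet\in\Theta$, each pair $\varphi_1:X_1\to Y_1$, $\varphi_2:X_2\to Y_2$ with $\varphi_2f_1=g_1\varphi_1$ can be completed to a morphism $X_\bullet\to Y_\bullet$; (N4) in (N3) the completion can be chosen such that the mapping cone $$X_2\oplus Y_1\xrightarrow{\left(\begin{smallmatrix}-f_2&0\\ \varphi_2&g_1\end{smallmatrix}\right)}X_3\oplus Y_2\to\cdots\to\Sigma X_1\oplus Y_n\xrightarrow{\left(\begin{smallmatrix}-\Sigma f_1&0\\ \Sigma\varphi_1&g_n\end{smallmatrix}\right)}\Sigma X_2\oplus\Sigma Y_1$$ belongs to $\Theta$. -/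

import Mathlib

open CategoryTheory CategoryTheory.Limits
open scoped ZeroObject

universe v u

-- With all of Mathlib imported, `X ⟶ Y` would otherwise be elaborated through reflexive quivers.
attribute [instance 2000] CategoryTheory.CategoryStruct.toQuiver

namespace NAngulated

noncomputable section

/-! ### Semisimple categories -/

/-- Every morphism is a split epimorphism followed by a split monomorphism. -/
def IsSemisimple (C : Type u) [Category.{v} C] : Prop :=
  ∀ {X Y : C} (f : X ⟶ Y), ∃ (Z : C) (g : X ⟶ Z) (h : Z ⟶ Y),
    IsSplitEpi g ∧ IsSplitMono h ∧ g ≫ h = f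

/-! ### `m`-abelian categories

A sequence `X⁰ ⟶ X¹ ⟶ ⋯ ⟶ Xᵐ⁺¹` is an object of `ComposableArrows C (m + 1)`; its `i`-th morphism
`dⁱ` is `S.map' i (i + 1)`. -/

section MAbelian

variable {C : Type u} [Category.{v} C] [Preadditive C] {m : ℕ}

/-- `(d¹, …, dᵐ)` is an `m`-cokernel of `d⁰`: for every object `Y` the sequence
`0 ⟶ C(Xᵐ⁺¹, Y) ⟶ C(Xᵐ, Y) ⟶ ⋯ ⟶ C(X¹, Y) ⟶ C(X⁰, Y)` is exact. -/
structure IsMCokernelSeq (S : ComposableArrows C (m + 1)) : Prop where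
  injective : ∀ Y : C, Function.Injective
    (fun h : S.obj' (m + 1) ⟶ Y => S.map' m (m + 1) ≫ h)
  exact : ∀ (Y : C) (i : ℕ) (hi : i < m), Function.Exact
    (fun h : S.obj' (i + 2) ⟶ Y => S.map' (i + 1) (i + 2) ≫ h)
    (fun g : S.obj' (i + 1) ⟶ Y => S.map' i (i + 1) ≫ g)

/-- `(d⁰, …, dᵐ⁻¹)` is an `m`-kernel of `dᵐ`: for every object `Y` the sequence
`0 ⟶ C(Y, X⁰) ⟶ C(Y, X¹) ⟶ ⋯ ⟶ C(Y, Xᵐ) ⟶ C(Y, Xᵐ⁺¹)` is exact. -/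
structure IsMKernelSeq (S : ComposableArrows C (m + 1)) : Prop where
  injective : ∀ Y : C, Function.Injective
    (fun h : Y ⟶ S.obj' 0 => h ≫ S.map' 0 1)
  exact : ∀ (Y : C) (i : ℕ) (hi : i < m), Function.Exact
    (fun h : Y ⟶ S.obj' i => h ≫ S.map' i (i + 1))
    (fun g : Y ⟶ S.obj' (i + 1) => g ≫ S.map' (i + 1) (i + 2))

/-- `m`-exact sequences. -/
structure IsMExact (S : ComposableArrows C (m + 1)) : Prop where
  kernel : IsMKernelSeq S
  cokernel : IsMCokernelSeq S

variable (C m) in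
/-- The axioms of an `m`-abelian category (for an additive category `C` and `m ≥ 1`). -/
structure IsMAbelian : Prop where
  /-- (A0) -/
  idempotentComplete : IsIdempotentComplete C
  /-- (A1), every morphism has an `m`-kernel -/
  exists_kernel : ∀ {X Y : C} (f : X ⟶ Y), ∃ S : ComposableArrows C (m + 1),
    Arrow.mk (S.map' m (m + 1)) = Arrow.mk f ∧ IsMKernelSeq S
  /-- (A1), every morphism has an `m`-cokernel -/
  exists_cokernel : ∀ {X Y : C} (f : X ⟶ Y), ∃ S : ComposableArrows C (m + 1),
    Arrow.mk (S.map' 0 1) = Arrow.mk f ∧ IsMCokernelSeq S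
  /-- (A2) -/
  exact_of_mono : ∀ S : ComposableArrows C (m + 1),
    Mono (S.map' 0 1) → IsMCokernelSeq S → IsMExact S
  /-- (A2) for the opposite category -/
  exact_of_epi : ∀ S : ComposableArrows C (m + 1),
    Epi (S.map' m (m + 1)) → IsMKernelSeq S → IsMExact S

end MAbelian

/-! ### `n`-angulated categories

The objects `X₁, …, Xₙ` of an `n`-`Σ`-sequence are indexed by `Fin n`, starting from `0`, and
addition in `Fin n` is cyclic. The functor `Σ` is written `F`. -/

section Angulated

variable {C : Type u} [Category.{v} C]

/-- Automorphisms of a category: functors with a strict two-sided inverse. -/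
def IsAutomorphism (F : C ⥤ C) : Prop :=
  ∃ G : C ⥤ C, F ⋙ G = 𝟭 C ∧ G ⋙ F = 𝟭 C

/-- The functor to be applied to the target of the `i`-th morphism of an `n`-`Σ`-sequence:
it is `Σ` for the last morphism, and the identity functor for all others. -/
def carry (F : C ⥤ C) {n : ℕ} (i : Fin n) : C ⥤ C :=
  if (i : ℕ) + 1 = n then F else 𝟭 C

theorem carry_of_ne (F : C ⥤ C) {n : ℕ} {i : Fin n} (h : (i : ℕ) + 1 ≠ n) :
    carry F i = 𝟭 C := if_neg h

theorem carry_of_eq (F : C ⥤ C) {n : ℕ} {i : Fin n} (h : (i : ℕ) + 1 = n) :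
    carry F i = F := if_pos h

/-- An `n`-`Σ`-sequence `X₀ ⟶ X₁ ⟶ ⋯ ⟶ Xₙ₋₁ ⟶ Σ X₀`: the morphism number `i` goes from `Xᵢ` to
`Xᵢ₊₁` for `i + 1 < n`, and from `Xₙ₋₁` to `Σ X₀` for `i = n - 1`. -/
structure Seq (F : C ⥤ C) (n : ℕ) [NeZero n] where
  obj : Fin n → C
  map : ∀ i : Fin n, obj i ⟶ (carry F i).obj (obj (i + 1))

namespace Seq

variable {F : C ⥤ C} {n : ℕ} [NeZero n]

/-- Morphisms of `n`-`Σ`-sequences. -/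
structure Hom (X Y : Seq F n) where
  app : ∀ i : Fin n, X.obj i ⟶ Y.obj i
  comm : ∀ i : Fin n, X.map i ≫ (carry F i).map (app (i + 1)) = app i ≫ Y.map i

/-- The left rotation `X₁ ⟶ X₂ ⟶ ⋯ ⟶ Xₙ₋₁ ⟶ Σ X₀ ⟶ Σ X₁`, whose last morphism is `(-1)ⁿ Σ f₀`. -/
def rotate [Preadditive C] (X : Seq F n) : Seq F n where
  obj i := (carry F i).obj (X.obj (i + 1))
  map i := (if (i : ℕ) + 1 = n then (-1 : ℤ) ^ n else 1) • (carry F i).map (X.map (i + 1))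

/-- The trivial sequence `A ⟶ A ⟶ 0 ⟶ ⋯ ⟶ 0 ⟶ Σ A`, whose first morphism is the identity. -/
def trivial [HasZeroMorphisms C] [HasZeroObject C] (F : C ⥤ C) (hn : 3 ≤ n) (A : C) :
    Seq F n where
  obj i := if (i : ℕ) ≤ 1 then A else 0
  map i := if h : i = 0 then eqToHom (by
      subst h
      have h1 : ((0 + 1 : Fin n) : ℕ) ≤ 1 := by
        rw [zero_add, Fin.val_one']; exact Nat.mod_le _ _
      rw [carry_of_ne F (by rw [Fin.val_zero]; omega), if_pos h1, if_pos (by simp)]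
      rfl) else 0

/-- The direct sum of two `n`-`Σ`-sequences. -/
def directSum [HasZeroMorphisms C] [HasBinaryBiproducts C] (X Y : Seq F n) : Seq F n where
  obj i := X.obj i ⊞ Y.obj i
  map i := biprod.desc (X.map i ≫ (carry F i).map biprod.inl)
    (Y.map i ≫ (carry F i).map biprod.inr)

/-- The mapping cone of `φ : X ⟶ Y`, with objects `X₁ ⊞ Y₀, X₂ ⊞ Y₁, …, Σ X₀ ⊞ Yₙ₋₁`. The `i`-th
morphism is `(-fᵢ₊₁, φᵢ₊₁)` on the first summand (with `Σ` applied to it when `i = n - 1`) and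
`(0, gᵢ)` on the second one. The target of the last morphism is `Σ (X₁ ⊞ Y₀)`, which is
`Σ X₁ ⊞ Σ Y₀`. -/
def cone [Preadditive C] [HasBinaryBiproducts C] {X Y : Seq F n} (φ : Hom X Y) : Seq F n where
  obj i := (carry F i).obj (X.obj (i + 1)) ⊞ Y.obj i
  map i := biprod.desc
    ((carry F i).map (biprod.lift (-X.map (i + 1)) (φ.app (i + 1))))
    (Y.map i ≫ (carry F i).map biprod.inr)

end Seq

variable [Preadditive C] [HasZeroObject C] [HasBinaryBiproducts C]

/-- Pre-`n`-angulations of `(C, Σ)`. -/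
structure IsPreNAngulation (F : C ⥤ C) (n : ℕ) [NeZero n] (Θ : Set (Seq F n)) : Prop where
  three_le : 3 ≤ n
  /-- (N1)(a), closure under isomorphisms -/
  mem_of_iso : ∀ {X Y : Seq F n} (φ : Seq.Hom X Y), (∀ i, IsIso (φ.app i)) → X ∈ Θ → Y ∈ Θ
  /-- (N1)(a), closure under direct sums -/
  directSum_mem : ∀ {X Y : Seq F n}, X ∈ Θ → Y ∈ Θ → X.directSum Y ∈ Θ
  /-- (N1)(a), closure under direct summands -/
  mem_of_directSum_mem : ∀ {X Y : Seq F n}, X.directSum Y ∈ Θ → X ∈ Θ ∧ Y ∈ Θ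
  /-- (N1)(b) -/
  trivial_mem : ∀ A : C, Seq.trivial F three_le A ∈ Θ
  /-- (N1)(c), every morphism is the first morphism of some element of `Θ` -/
  exists_mem : ∀ {A B : C} (f : A ⟶ B), ∃ X ∈ Θ, Arrow.mk (X.map 0) = Arrow.mk f
  /-- (N2) -/
  rotate_mem_iff : ∀ X : Seq F n, X ∈ Θ ↔ X.rotate ∈ Θ
  /-- (N3) -/
  exists_hom : ∀ {X Y : Seq F n}, X ∈ Θ → Y ∈ Θ →
    ∀ (a : X.obj 0 ⟶ Y.obj 0) (b : X.obj (0 + 1) ⟶ Y.obj (0 + 1)),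
      X.map 0 ≫ (carry F 0).map b = a ≫ Y.map 0 →
      ∃ φ : Seq.Hom X Y, φ.app 0 = a ∧ φ.app (0 + 1) = b

/-- `n`-angulations of `(C, Σ)`. -/
structure IsNAngulation (F : C ⥤ C) (n : ℕ) [NeZero n] (Θ : Set (Seq F n)) : Prop
    extends IsPreNAngulation F n Θ where
  /-- (N4) -/
  exists_cone_mem : ∀ {X Y : Seq F n}, X ∈ Θ → Y ∈ Θ →
    ∀ (a : X.obj 0 ⟶ Y.obj 0) (b : X.obj (0 + 1) ⟶ Y.obj (0 + 1)),
      X.map 0 ≫ (carry F 0).map b = a ≫ Y.map 0 →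
      ∃ φ : Seq.Hom X Y, φ.app 0 = a ∧ φ.app (0 + 1) = b ∧ Seq.cone φ ∈ Θ

/-- `(C, Σ)` admits an `n`-angulation. -/
def AdmitsNAngulation (F : C ⥤ C) (n : ℕ) [NeZero n] : Prop :=
  ∃ Θ : Set (Seq F n), IsNAngulation F n Θ

variable (C) in
/-- `C` is an `n`-angulated category, for some automorphism and some class of `n`-angles. -/
def IsNAngulatedCategory (n : ℕ) [NeZero n] : Prop :=
  ∃ F : C ⥤ C, IsAutomorphism F ∧ AdmitsNAngulation F n

end Angulated

end

end NAngulated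

/-! The bridge between the two structures is that every monomorphism of a pre-`n`-angulated category
splits (`IsPreNAngulation.isSplitMono_of_mono`). Complete a monomorphism `f` to an `n`-angle. The
last morphism composed with `Σ f` is zero and `Σ f` is mono, so the last morphism vanishes. Hence
`0` and the identity of the first object commute with the last morphisms and extend, by rotated
(N3), to a morphism into the trivial `n`-angle; its square at the first morphism exhibits a
retraction of `f`.

Now let `f` be any morphism of a category that is also `m`-abelian, and take an `m`-kernel of it.
The sequence begins with a monomorphism, which splits. Inductively, the image of each morphism is a
direct summand, and the next morphism is mono on a complement of it, hence split mono there. At the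
end of the sequence stands `f` (`IsMKernelSeq.exists_factorization`).

Conversely, in a semisimple category each `d` has some `t` with `d t d = d`. Ordinary kernels and
cokernels padded by zeros give `m`-kernels and `m`-cokernels, and `t` turns exactness of Hom in one
variable into exactness in the other. For the `n`-angulation take all exact sequences. Exactness is
stable under rotation, sums, summands and all mapping cones, so (N4) follows from (N3); `t` provides
the homotopies that prove (N3); and each morphism starts a sum of three contractible sequences. -/

namespace NAngulated

/-! ### Regular morphisms and splittings in semisimple categories. -/

section Semisimple

variable {C : Type u} [Category.{v} C]

/-- In a semisimple category every morphism is von Neumann regular. -/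
theorem IsSemisimple.exists_regular (hC : IsSemisimple C) {X Y : C} (f : X ⟶ Y) :
    ∃ t : Y ⟶ X, f ≫ t ≫ f = f := by
  obtain ⟨Z, g, h, hg, hh, rfl⟩ := hC f
  exact ⟨retraction h ≫ section_ g, by simp⟩

theorem IsSemisimple.isIdempotentComplete (hC : IsSemisimple C) : IsIdempotentComplete C where
  idempotents_split X p hp := by
    obtain ⟨Z, g, h, hg, hh, rfl⟩ := hC p
    refine ⟨Z, h, g, ?_, rfl⟩
    rw [← cancel_epi g, ← cancel_mono h]
    simpa using hp

variable [Preadditive C]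

/-- The idempotent complement of a split epimorphism. -/
theorem exists_kernel_splitting [IsIdempotentComplete C] {X Z : C} (g : X ⟶ Z) (s : Z ⟶ X)
    (hs : s ≫ g = 𝟙 Z) :
    ∃ (K : C) (k : K ⟶ X) (p : X ⟶ K), k ≫ p = 𝟙 K ∧ k ≫ g = 0 ∧ s ≫ p = 0 ∧
      p ≫ k + g ≫ s = 𝟙 X := by
  have hs' : ∀ {W : C} (w : Z ⟶ W), s ≫ g ≫ w = w := fun w => by
    rw [← Category.assoc, hs, Category.id_comp]
  obtain ⟨K, k, p, hkp, hpk⟩ :=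
    IsIdempotentComplete.idempotents_split X (𝟙 X - g ≫ s) (by simp [hs'])
  have hp : ∀ {W : C} (w w' : W ⟶ K), w ≫ k = w' ≫ k → w = w' := fun w w' h => by
    simpa [hkp] using h =≫ p
  refine ⟨K, k, p, hkp, ?_, ?_, by rw [hpk]; simp⟩
  · have : p ≫ k ≫ g = 0 := by
      rw [← Category.assoc, hpk]; simp [hs]
    simpa [reassoc_of% hkp] using k ≫= this
  · apply hp
    rw [Category.assoc, hpk]
    simp [hs']

/-- Left exactness of the sequences of represented functors implies right exactness. -/
theorem exact_post_of_exact_pre {X Y Z : C} (d : X ⟶ Y) (d' : Y ⟶ Z)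
    (ht : ∃ t : Y ⟶ X, d ≫ t ≫ d = d)
    (h : ∀ W : C, Function.Exact (fun g : Z ⟶ W => d' ≫ g) (fun g : Y ⟶ W => d ≫ g)) (W : C) :
    Function.Exact (fun g : W ⟶ X => g ≫ d) (fun g : W ⟶ Y => g ≫ d') := by
  obtain ⟨t, ht⟩ := ht
  have hd : d ≫ d' = 0 := (h Z d').2 ⟨𝟙 Z, by simp⟩
  -- Since `d t d = d`, the morphism `1 - t d` is killed by `d`, so it is `d' q`. Any `y` with `y d'
  -- = 0` then satisfies `y = y t d`.
  obtain ⟨q, hq⟩ := (h Y (𝟙 Y - t ≫ d)).1 (by simp [ht])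
  intro y
  constructor
  · intro hy
    refine ⟨y ≫ t, ?_⟩
    have := y ≫= hq
    simp only [reassoc_of% (show y ≫ d' = 0 from hy), zero_comp, Preadditive.comp_sub,
      Category.comp_id] at this
    simpa using (sub_eq_zero.1 this.symm).symm
  · rintro ⟨x, rfl⟩
    simp [hd]

/-- Right exactness of the sequences of represented functors implies left exactness. -/
theorem exact_pre_of_exact_post {X Y Z : C} (d : X ⟶ Y) (d' : Y ⟶ Z)
    (ht : ∃ t : Z ⟶ Y, d' ≫ t ≫ d' = d')
    (h : ∀ W : C, Function.Exact (fun g : W ⟶ X => g ≫ d) (fun g : W ⟶ Y => g ≫ d')) (W : C) :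
    Function.Exact (fun g : Z ⟶ W => d' ≫ g) (fun g : Y ⟶ W => d ≫ g) := by
  obtain ⟨t, ht⟩ := ht
  have hd : d ≫ d' = 0 := (h X d).2 ⟨𝟙 X, by simp⟩
  obtain ⟨q, hq⟩ := (h Y (𝟙 Y - d' ≫ t)).1 (by simp [ht])
  intro y
  constructor
  · intro hy
    refine ⟨t ≫ y, ?_⟩
    have := hq =≫ y
    simp only [Category.assoc, show d ≫ y = 0 from hy, comp_zero, Preadditive.sub_comp,
      Category.id_comp] at this
    exact (sub_eq_zero.1 this.symm).symm
  · rintro ⟨x, rfl⟩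
    simp [reassoc_of% hd]

end Semisimple

/-! ### Semisimplicity and `m`-abelian categories. -/

section MAbelian

variable {C : Type u} [Category.{v} C] [Preadditive C]

theorem isMCokernelSeq_mk₁ {X Y : C} (f : X ⟶ Y) [Epi f] :
    IsMCokernelSeq (m := 0) (ComposableArrows.mk₁ f) where
  injective _ _ _ h := (cancel_epi f).1 h
  exact _ i hi := absurd hi (Nat.not_lt_zero i)

theorem IsMCokernelSeq.precomp {m : ℕ} {S : ComposableArrows C (m + 1)} (hS : IsMCokernelSeq S)
    {X : C} (f : X ⟶ S.left)
    (hf : ∀ W : C, Function.Exact (fun g : S.obj' 1 ⟶ W => S.map' 0 1 ≫ g)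
      (fun g : S.obj' 0 ⟶ W => f ≫ g)) :
    IsMCokernelSeq (m := m + 1) (S.precomp f) where
  injective W := hS.injective W
  exact W i hi := by
    cases i with
    | zero => exact hf W
    | succ i => exact hS.exact W i (by omega)

theorem IsMKernelSeq.precomp_zero [HasZeroObject C] {m : ℕ} {S : ComposableArrows C (m + 1)}
    (hS : IsMKernelSeq S) : IsMKernelSeq (m := m + 1) (S.precomp (0 : (0 : C) ⟶ S.left)) where
  injective W g g' _ := (isZero_zero C).eq_of_tgt g g'
  exact W i hi := by
    cases i with
    | zero =>
      intro y
      constructor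
      · intro hy
        refine ⟨0, ?_⟩
        apply hS.injective W
        exact ((zero_comp =≫ S.map' 0 1).trans zero_comp).trans (Eq.symm hy)
      · rintro ⟨x, rfl⟩
        exact (Category.assoc _ _ _).trans ((x ≫= zero_comp).trans comp_zero)
    | succ i => exact hS.exact W i (by omega)

theorem isMKernelSeq_mk₂ {K X Y : C} (k : K ⟶ X) (f : X ⟶ Y) [Mono k]
    (h : ∀ W : C, Function.Exact (fun g : W ⟶ K => g ≫ k) (fun g : W ⟶ X => g ≫ f)) :
    IsMKernelSeq (m := 1) (ComposableArrows.mk₂ k f) where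
  injective W g g' h := (cancel_mono k).1 h
  exact W i hi := by
    obtain rfl : i = 0 := by omega
    exact h W

/-- An ordinary kernel becomes a longer one when zero objects are prepended. -/
theorem exists_isMKernelSeq [HasZeroObject C] {K X Y : C} (k : K ⟶ X) (f : X ⟶ Y) [Mono k]
    (h : ∀ W : C, Function.Exact (fun g : W ⟶ K => g ≫ k) (fun g : W ⟶ X => g ≫ f)) (m : ℕ) :
    ∃ S : ComposableArrows C (m + 1 + 1),
      Arrow.mk (S.map' (m + 1) (m + 1 + 1)) = Arrow.mk f ∧ IsMKernelSeq (m := m + 1) S := by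
  induction m with
  | zero => exact ⟨_, rfl, isMKernelSeq_mk₂ k f h⟩
  | succ m ih =>
    obtain ⟨S, hS, hS'⟩ := ih
    exact ⟨_, hS, hS'.precomp_zero⟩

/-- The zeros belong on the right, but the sequence is built by prepending: the inductive hypothesis
is applied to the epimorphism `Y ⟶ 0`, which is why it ranges over all epimorphisms. -/
theorem exists_isMCokernelSeq_of_epi [HasZeroObject C] (m : ℕ) :
    ∀ {X Y : C} (f : X ⟶ Y) [Epi f], ∃ S : ComposableArrows C (m + 1),
      Arrow.mk (S.map' 0 1) = Arrow.mk f ∧ IsMCokernelSeq S := by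
  induction m with
  | zero => exact fun f _ => ⟨_, rfl, isMCokernelSeq_mk₁ f⟩
  | succ m ih =>
    intro X Y f hf
    have : Epi (0 : Y ⟶ (0 : C)) := ⟨fun g g' _ => (isZero_zero C).eq_of_src g g'⟩
    obtain ⟨S, hS, hS'⟩ := ih (0 : Y ⟶ (0 : C))
    obtain rfl : S.left = Y := congrArg Comma.left hS
    refine ⟨_, rfl, hS'.precomp f fun W y => ?_⟩
    have hz : S.map' 0 1 = 0 := by
      have h1 : S.obj' 1 = 0 := congrArg Comma.right hS
      exact ((isZero_zero C).of_iso (eqToIso h1)).eq_of_tgt _ _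
    constructor
    · intro hy
      refine ⟨0, ?_⟩
      rw [← cancel_epi f]
      exact ((f ≫= comp_zero).trans comp_zero).trans (Eq.symm hy)
    · rintro ⟨x, rfl⟩
      change f ≫ S.map' 0 1 ≫ x = 0
      rw [hz, zero_comp, comp_zero]

theorem exists_isMCokernelSeq [HasZeroObject C] {X Y Z : C} (f : X ⟶ Y) (c : Y ⟶ Z) [Epi c]
    (h : ∀ W : C, Function.Exact (fun g : Z ⟶ W => c ≫ g) (fun g : Y ⟶ W => f ≫ g)) (m : ℕ) :
    ∃ S : ComposableArrows C (m + 1 + 1),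
      Arrow.mk (S.map' 0 1) = Arrow.mk f ∧ IsMCokernelSeq (m := m + 1) S := by
  obtain ⟨S, hS, hS'⟩ := exists_isMCokernelSeq_of_epi m c
  obtain rfl : S.left = Y := congrArg Comma.left hS
  obtain rfl : S.obj' 1 = Z := congrArg Comma.right hS
  obtain rfl : S.map' 0 1 = c := Arrow.mk_injective _ _ hS
  exact ⟨_, rfl, hS'.precomp f h⟩

/-- Semisimple additive categories are `m`-abelian. -/
theorem IsSemisimple.isMAbelian [HasZeroObject C] (hC : IsSemisimple C) {m : ℕ} (hm : 1 ≤ m) :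
    IsMAbelian C m where
  idempotentComplete := hC.isIdempotentComplete
  exists_kernel {X Y} f := by
    obtain ⟨m, rfl⟩ := Nat.exists_eq_add_of_le' hm
    have := hC.isIdempotentComplete
    obtain ⟨Z, g, h, hg, hh, rfl⟩ := hC f
    obtain ⟨K, k, p, hkp, hkg, -, hpk⟩ := exists_kernel_splitting g (section_ g) (by simp)
    have : Mono k := mono_of_mono_fac hkp
    refine exists_isMKernelSeq k (g ≫ h) (fun W y => ⟨fun hy => ⟨y ≫ p, ?_⟩, ?_⟩) m
    · have hy' : y ≫ g = 0 := by simpa [← cancel_mono h] using hy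
      simpa [reassoc_of% hy'] using y ≫= hpk
    · rintro ⟨x, rfl⟩
      simp [reassoc_of% hkg]
  exists_cokernel {X Y} f := by
    obtain ⟨m, rfl⟩ := Nat.exists_eq_add_of_le' hm
    have := hC.isIdempotentComplete
    obtain ⟨Z, g, h, hg, hh, rfl⟩ := hC f
    obtain ⟨K, k, p, hkp, -, hhp, hpk⟩ := exists_kernel_splitting (retraction h) h (by simp)
    have : Epi p := epi_of_epi_fac hkp
    refine exists_isMCokernelSeq (g ≫ h) p (fun W y => ⟨fun hy => ⟨k ≫ y, ?_⟩, ?_⟩) m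
    · have hy' : h ≫ y = 0 := by simpa [← cancel_epi g] using hy
      simpa [hy'] using hpk =≫ y
    · rintro ⟨x, rfl⟩
      simp [reassoc_of% hhp]
  exact_of_mono S hS hS' :=
    ⟨⟨fun W g g' h => (cancel_mono _).1 h, fun W i hi =>
      exact_post_of_exact_pre _ _ (hC.exists_regular _) (fun W => hS'.exact W i hi) W⟩, hS'⟩
  exact_of_epi S hS hS' :=
    ⟨hS', ⟨fun W g g' h => (cancel_epi _).1 h, fun W i hi =>
      exact_pre_of_exact_post _ _ (hC.exists_regular _) (fun W => hS'.exact W i hi) W⟩⟩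

/-- If the monomorphisms of an idempotent complete category split, all morphisms of an `m`-kernel
sequence are split epimorphisms followed by split monomorphisms. -/
theorem IsMKernelSeq.exists_factorization [IsIdempotentComplete C]
    (hmono : ∀ {X Y : C} (f : X ⟶ Y), Mono f → IsSplitMono f) {m : ℕ}
    {S : ComposableArrows C (m + 1)} (hS : IsMKernelSeq S) (i : ℕ) (hi : i < m + 1) :
    ∃ (Z : C) (g : S.obj' i ⟶ Z) (h : Z ⟶ S.obj' (i + 1)),
      IsSplitEpi g ∧ IsSplitMono h ∧ g ≫ h = S.map' i (i + 1) := by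
  induction i with
  | zero =>
    have : Mono (S.map' 0 1) := ⟨fun g g' h => hS.injective _ h⟩
    exact ⟨_, 𝟙 _, S.map' 0 1, inferInstance, hmono _ this, Category.id_comp _⟩
  | succ i ih =>
    obtain ⟨Z, g, h, hg, hh, hgh⟩ := ih (by omega)
    obtain ⟨K, k, p, hkp, hkr, hhp, hpk⟩ := exists_kernel_splitting (retraction h) h (by simp)
    have hex := fun W => hS.exact W i (by omega)
    have hd : S.map' i (i + 1) ≫ S.map' (i + 1) (i + 2) = 0 :=
      (hex _ (S.map' i (i + 1))).2 ⟨𝟙 _, Category.id_comp _⟩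
    have hhd : h ≫ S.map' (i + 1) (i + 2) = 0 := by
      rw [← cancel_epi g, ← Category.assoc, hgh, hd, comp_zero]
    -- `K` is a complement of the image `Z` of the previous morphism. The next one vanishes on `Z`,
    -- so it factors through `p`. If it kills `y ≫ k`, then by exactness `y ≫ k` comes from `Z`, and
    -- `p` sends it both to `0` and to `y`.
    refine ⟨K, p, k ≫ S.map' (i + 1) (i + 2), ⟨⟨k, hkp⟩⟩, hmono _ ?_, ?_⟩
    · refine Preadditive.mono_of_cancel_zero _ fun {W} y hy => ?_
      obtain ⟨x, hx⟩ := (hex W (y ≫ k)).1 (by simpa using hy)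
      have hx' : x ≫ S.map' i (i + 1) = y ≫ k := hx
      rw [← hgh] at hx'
      simpa [hhp, hkp] using (hx' =≫ p).symm
    · have := hpk =≫ S.map' (i + 1) (i + 2)
      simpa [hhd] using this

theorem IsMAbelian.isSemisimple {m : ℕ} (hC : IsMAbelian C m)
    (hmono : ∀ {X Y : C} (f : X ⟶ Y), Mono f → IsSplitMono f) : IsSemisimple C := by
  intro X Y f
  have := hC.idempotentComplete
  obtain ⟨S, hS, hS'⟩ := hC.exists_kernel f
  obtain rfl : S.obj' m = X := congrArg Comma.left hS
  obtain rfl : S.obj' (m + 1) = Y := congrArg Comma.right hS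
  obtain rfl : S.map' m (m + 1) = f := Arrow.mk_injective _ _ hS
  exact hS'.exists_factorization hmono m (by omega)

end MAbelian

/-! ### Automorphisms as additive equivalences. -/

section Automorphism

variable {C : Type u} [Category.{v} C]

theorem IsAutomorphism.isEquivalence {F : C ⥤ C} (hF : IsAutomorphism F) : F.IsEquivalence := by
  obtain ⟨G, h, h'⟩ := hF
  exact (CategoryTheory.Equivalence.mk F G (eqToIso h.symm) (eqToIso h')).isEquivalence_functor

instance (F : C ⥤ C) [F.IsEquivalence] {n : ℕ} (i : Fin n) : (carry F i).IsEquivalence := by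
  unfold carry
  split_ifs <;> infer_instance

instance [Preadditive C] (F : C ⥤ C) [F.Additive] {n : ℕ} (i : Fin n) :
    (carry F i).Additive := by
  unfold carry
  split_ifs <;> infer_instance

/-- Additivity of `Σ` is not part of the definitions: an equivalence preserves binary products,
hence biproducts, and these determine addition of morphisms. -/
theorem additive_of_isEquivalence [Preadditive C] [HasBinaryBiproducts C] (F : C ⥤ C)
    [F.IsEquivalence] : F.Additive := by
  have := Limits.preservesBinaryBiproducts_of_preservesBinaryProducts F
  exact F.additive_of_preservesBinaryBiproducts

end Automorphism

/-! ### Signs of the rotation and cyclic indices. -/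

section

variable {C : Type u} [Category.{v} C] [Preadditive C] {F : C ⥤ C} {n : ℕ} [NeZero n]

/-- The sign of the `i`-th morphism of the rotation. -/
def rotateSign {n : ℕ} (i : Fin n) : ℤ := if (i : ℕ) + 1 = n then (-1 : ℤ) ^ n else 1

theorem rotateSign_mul_self {n : ℕ} (i : Fin n) : rotateSign i * rotateSign i = 1 := by
  unfold rotateSign
  split_ifs
  · rw [← mul_pow]; simp
  · rfl

theorem rotateSign_smul_eq_zero {n : ℕ} (i : Fin n) {X Y : C} {f : X ⟶ Y} :
    rotateSign i • f = 0 ↔ f = 0 := by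
  constructor
  · intro h
    simpa [smul_smul, rotateSign_mul_self] using congrArg (rotateSign i • ·) h
  · rintro rfl
    exact smul_zero _

theorem rotateSign_smul_inj {n : ℕ} (i : Fin n) {X Y : C} {f g : X ⟶ Y} :
    rotateSign i • f = rotateSign i • g ↔ f = g := by
  rw [← sub_eq_zero, ← smul_sub, rotateSign_smul_eq_zero, sub_eq_zero]

theorem rotateSign_comp_eq_zero_iff (G : C ⥤ C) [G.Faithful] [G.Additive] {n : ℕ} (i j : Fin n)
    {X Y Z : C} (f : X ⟶ Y) (g : Y ⟶ Z) :
    (rotateSign i • G.map f) ≫ G.map (rotateSign j • g) = 0 ↔ f ≫ g = 0 := by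
  rw [Functor.map_zsmul, Preadditive.zsmul_comp, Preadditive.comp_zsmul, rotateSign_smul_eq_zero,
    rotateSign_smul_eq_zero, ← G.map_comp, Functor.map_eq_zero_iff]

theorem rotateSign_comm_iff (G : C ⥤ C) [G.Faithful] [G.Additive] {n : ℕ} (i : Fin n)
    {X Y X' Y' : C} (f : X ⟶ Y) (f' : X' ⟶ Y') (a : X ⟶ X') (b : Y ⟶ Y') :
    (rotateSign i • G.map f) ≫ G.map b = G.map a ≫ (rotateSign i • G.map f') ↔
      f ≫ b = a ≫ f' := by
  rw [Preadditive.zsmul_comp, Preadditive.comp_zsmul, rotateSign_smul_inj, ← G.map_comp,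
    ← G.map_comp, G.map_injective.eq_iff]

theorem Seq.rotate_comp_eq_zero_iff [F.IsEquivalence] [F.Additive] (X : Seq F n) (i : Fin n) :
    X.rotate.map i ≫ (carry F i).map (X.rotate.map (i + 1)) = 0 ↔
      X.map (i + 1) ≫ (carry F (i + 1)).map (X.map (i + 1 + 1)) = 0 :=
  rotateSign_comp_eq_zero_iff (carry F i) i (i + 1) _ _

/-- Carries statements known at the first morphism around the sequence, one rotation at a time. -/
theorem fin_cyclic_induction {P : Fin n → Prop} (h0 : P 0) (h : ∀ i, P i → P (i + 1))
    (i : Fin n) : P i := by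
  obtain ⟨i, hi⟩ := i
  induction i with
  | zero => exact h0
  | succ i ih =>
    have := h _ (ih (by omega))
    convert this using 1
    ext
    rw [Fin.val_add_one_of_lt' (by simpa using hi)]

theorem fin_add_one_ne (hn : 3 ≤ n) (i : Fin n) : i + 1 ≠ i := by
  intro h
  have h1 : (1 : Fin n) = 0 := by simpa using h
  have := congrArg Fin.val h1
  rw [Fin.val_one', Nat.mod_eq_of_lt (by omega)] at this
  simp at this

theorem fin_val_zero_add_one (hn : 3 ≤ n) : ((0 + 1 : Fin n) : ℕ) = 1 := by
  rw [zero_add, Fin.val_one', Nat.mod_eq_of_lt (by omega)]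

theorem fin_val_zero_add_one_add_one (hn : 3 ≤ n) : ((0 + 1 + 1 : Fin n) : ℕ) = 2 := by
  rw [Fin.val_add_one_of_lt' (by rw [fin_val_zero_add_one hn]; omega), fin_val_zero_add_one hn]

theorem fin_add_one_add_one_ne (hn : 3 ≤ n) (i : Fin n) : i + 1 + 1 ≠ i := by
  intro h
  have h1 : (0 + 1 + 1 : Fin n) = 0 := by simpa [add_assoc] using h
  have := congrArg Fin.val h1
  rw [fin_val_zero_add_one_add_one hn] at this
  simp at this

namespace Seq

variable {C : Type u} [Category.{v} C] [HasZeroMorphisms C] [HasZeroObject C]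
  (F : C ⥤ C) (hn : 3 ≤ n) (A : C)

instance isIso_trivial_map_zero : IsIso ((trivial F hn A).map 0) := by
  dsimp only [trivial]
  rw [dif_pos rfl]
  infer_instance

theorem trivial_obj_zero : (trivial F hn A).obj 0 = A := by
  simp [trivial]

theorem isZero_trivial_obj {i : Fin n} (hi : 1 < (i : ℕ)) : IsZero ((trivial F hn A).obj i) := by
  dsimp only [trivial]
  rw [if_neg (by omega)]
  exact isZero_zero C

end Seq

end

/-! ### Monomorphisms split in pre-`n`-angulated categories. -/

namespace IsPreNAngulation

variable {C : Type u} [Category.{v} C] [Preadditive C] [HasZeroObject C] [HasBinaryBiproducts C]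
  {F : C ⥤ C} {n : ℕ} [NeZero n] {Θ : Set (Seq F n)}

theorem comp_eq_zero [F.IsEquivalence] [F.Additive] (h : IsPreNAngulation F n Θ) (i : Fin n) :
    ∀ X ∈ Θ, X.map i ≫ (carry F i).map (X.map (i + 1)) = 0 := by
  induction i using fin_cyclic_induction with
  | h0 =>
    intro X hX
    let T := Seq.trivial F h.three_le (X.obj 0)
    -- The identity and `f₀` extend to a morphism from the trivial sequence on `X₀`. The second
    -- morphism of that sequence is zero, so the next square reads `f₀ f₁ = 0`.
    obtain ⟨φ, -, hφ⟩ := h.exists_hom (h.trivial_mem (X.obj 0)) hX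
      (eqToHom (Seq.trivial_obj_zero F h.three_le (X.obj 0)))
      ((carry F 0).preimage
        (inv (T.map 0) ≫ eqToHom (Seq.trivial_obj_zero F h.three_le (X.obj 0)) ≫ X.map 0))
      (by simp [T])
    have hT : T.map (0 + 1) = 0 := ((carry F (0 + 1 : Fin n)).map_isZero (Seq.isZero_trivial_obj F
      h.three_le (X.obj 0) (by rw [fin_val_zero_add_one_add_one h.three_le]; simp))).eq_of_tgt _ _
    have := φ.comm (0 + 1)
    rw [hφ, show (Seq.trivial F _ (X.obj 0)).map (0 + 1) = 0 from hT, zero_comp] at this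
    simpa using (congrArg (carry F (0 : Fin n)).map this).symm
  | h i ih =>
    exact fun X hX => (X.rotate_comp_eq_zero_iff i).1 (ih _ ((h.rotate_mem_iff X).1 hX))

theorem exists_hom_at [F.IsEquivalence] [F.Additive] (h : IsPreNAngulation F n Θ) (i : Fin n) :
    ∀ {X Y : Seq F n}, X ∈ Θ → Y ∈ Θ →
      ∀ (a : X.obj i ⟶ Y.obj i) (b : X.obj (i + 1) ⟶ Y.obj (i + 1)),
        X.map i ≫ (carry F i).map b = a ≫ Y.map i →
        ∃ φ : Seq.Hom X Y, φ.app i = a ∧ φ.app (i + 1) = b := by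
  induction i using fin_cyclic_induction with
  | h0 => exact h.exists_hom
  | h i ih =>
    intro X Y hX hY a b hab
    obtain ⟨φ, hφ, hφ'⟩ := ih ((h.rotate_mem_iff X).1 hX) ((h.rotate_mem_iff Y).1 hY)
      ((carry F i).map a) ((carry F (i + 1)).map b)
      ((rotateSign_comm_iff (carry F i) i _ _ _ _).2 hab)
    -- The component of `φ` at `k` must be moved to index `k + 1` and stripped of `carry F k`.
    -- Quantifying over `k` with `k + 1 = j` keeps the transports out of the choice of `ψ`.
    have : ∀ j, ∃ ψ : X.obj j ⟶ Y.obj j, ∀ k (hk : k + 1 = j),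
        φ.app k = (carry F k).map
          (eqToHom (by rw [hk]) ≫ ψ ≫ eqToHom (by rw [hk]) : X.obj (k + 1) ⟶ Y.obj (k + 1)) := by
      intro j
      obtain ⟨j, rfl⟩ : ∃ k, k + 1 = j := ⟨j - 1, by simp⟩
      refine ⟨(carry F j).preimage (φ.app j), fun k hk => ?_⟩
      obtain rfl : k = j := by simpa using hk
      simp only [eqToHom_refl, Category.id_comp, Category.comp_id]
      exact ((carry F k).map_preimage (φ.app k)).symm
    choose ψ hψ using this
    replace hψ : ∀ k, φ.app k = (carry F k).map (ψ (k + 1)) := fun k => by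
      simpa using hψ (k + 1) k rfl
    refine ⟨⟨ψ, fun j => ?_⟩, ?_, ?_⟩
    · obtain ⟨j, rfl⟩ : ∃ k, k + 1 = j := ⟨j - 1, by simp⟩
      have := φ.comm j
      rw [hψ, hψ] at this
      exact (rotateSign_comm_iff (carry F j) j _ _ _ _).1 this
    · exact (carry F i).map_injective ((hψ i).symm.trans hφ)
    · exact (carry F (i + 1)).map_injective ((hψ (i + 1)).symm.trans hφ')

theorem isSplitMono_map_zero [F.IsEquivalence] [F.Additive] (h : IsPreNAngulation F n Θ)
    {X : Seq F n} (hX : X ∈ Θ) [hm : Mono (X.map 0)] : IsSplitMono (X.map 0) := by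
  -- `i` is the last index, so `X.map i` lands in `Σ X₀`.
  obtain ⟨i, hi⟩ : ∃ i : Fin n, i + 1 = 0 := ⟨-1, by simp⟩
  have hm' : Mono (X.map (i + 1)) := by rw [hi]; exact hm
  have h0 : X.map i = 0 := by
    rw [← cancel_mono ((carry F i).map (X.map (i + 1))), h.comp_eq_zero i X hX, zero_comp]
  let T := Seq.trivial F h.three_le (X.obj 0)
  have hT : X.obj (i + 1) = T.obj (i + 1) := by
    rw [hi]; exact (Seq.trivial_obj_zero F h.three_le (X.obj 0)).symm
  obtain ⟨φ, -, hφ⟩ := h.exists_hom_at i hX (h.trivial_mem (X.obj 0)) 0 (eqToHom hT)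
    (by rw [h0, zero_comp, zero_comp])
  have : IsIso (φ.app (i + 1)) := by rw [hφ]; infer_instance
  rw [hi] at this
  have hc := φ.comm 0
  exact ⟨⟨⟨(carry F 0).map (φ.app (0 + 1)) ≫ inv (φ.app 0 ≫ (Seq.trivial F _ _).map 0), by
    rw [← Category.assoc, hc, IsIso.hom_inv_id]⟩⟩⟩

theorem isSplitMono_of_mono [F.IsEquivalence] [F.Additive] (h : IsPreNAngulation F n Θ)
    {X Y : C} (f : X ⟶ Y) (hf : Mono f) : IsSplitMono f := by
  obtain ⟨S, hS, hSf⟩ := h.exists_mem f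
  have key : Mono (Arrow.mk (S.map 0)).hom → IsSplitMono (Arrow.mk (S.map 0)).hom :=
    fun hm => h.isSplitMono_map_zero hS (hm := hm)
  rw [hSf] at key
  exact key hf

end IsPreNAngulation

/-! ### Exact sequences and their closure properties. -/

namespace Seq

variable {C : Type u} [Category.{v} C] [Preadditive C] {F : C ⥤ C} {n : ℕ} [NeZero n]

/-- Exactness of an `n`-`Σ`-sequence at all its terms, tested on generalized elements. -/
structure IsExact (X : Seq F n) : Prop where
  zero : ∀ i : Fin n, X.map i ≫ (carry F i).map (X.map (i + 1)) = 0
  lift : ∀ (i : Fin n) {T : C} (y : T ⟶ X.obj (i + 1)), y ≫ X.map (i + 1) = 0 →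
    ∃ x : (carry F i).obj T ⟶ X.obj i, x ≫ X.map i = (carry F i).map y

theorem fin_forall_add_one {P : Fin n → Prop} : (∀ i, P (i + 1)) ↔ ∀ i, P i :=
  ⟨fun h i => by simpa using h (i - 1), fun h i => h _⟩

-- Signs are units and can be absorbed into the lift `x`; an arbitrary test object is isomorphic to
-- one in the image of `carry F j`.
omit [NeZero n] in
theorem rotateSign_lift_iff [F.IsEquivalence] [F.Additive] {i j : Fin n} {X Y Z : C}
    (f : X ⟶ (carry F j).obj Y) (g : Y ⟶ Z) :
    (∀ {T : C} (y : T ⟶ (carry F j).obj Y), y ≫ (rotateSign j • (carry F j).map g) = 0 →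
      ∃ x : (carry F i).obj T ⟶ (carry F i).obj X,
        x ≫ (rotateSign i • (carry F i).map f) = (carry F i).map y) ↔
    (∀ {T : C} (y : T ⟶ Y), y ≫ g = 0 →
      ∃ x : (carry F j).obj T ⟶ X, x ≫ f = (carry F j).map y) := by
  constructor
  · intro h T y hy
    obtain ⟨x, hx⟩ := h ((carry F j).map y) (by
      rw [Preadditive.comp_zsmul, ← Functor.map_comp, hy, Functor.map_zero, smul_zero])
    obtain ⟨x, rfl⟩ := (carry F i).map_surjective x
    refine ⟨rotateSign i • x, (carry F i).map_injective ?_⟩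
    rw [← hx]
    simp
  · intro h T y hy
    let e := (carry F j).objObjPreimageIso T
    obtain ⟨y', hy'⟩ := (carry F j).map_surjective (e.hom ≫ y)
    obtain ⟨x, hx⟩ := h y' (by
      apply (carry F j).map_injective
      rw [Preadditive.comp_zsmul, rotateSign_smul_eq_zero] at hy
      rw [Functor.map_comp, hy', Category.assoc, hy, comp_zero, Functor.map_zero])
    refine ⟨rotateSign i • (carry F i).map (e.inv ≫ x), ?_⟩
    rw [Preadditive.comp_zsmul, Preadditive.zsmul_comp, smul_smul, rotateSign_mul_self, one_smul,
      ← Functor.map_comp, Category.assoc, hx, hy', e.inv_hom_id_assoc]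

/-- Exactness of the rotation at `i` is exactness of `X` at `i + 1`, and the shift permutes the
cyclic indices. -/
theorem isExact_rotate_iff [F.IsEquivalence] [F.Additive] (X : Seq F n) :
    X.rotate.IsExact ↔ X.IsExact := by
  constructor
  · exact fun h => ⟨fin_forall_add_one.1 fun i => (X.rotate_comp_eq_zero_iff i).1 (h.zero i),
      fin_forall_add_one.1 fun i T => (rotateSign_lift_iff _ _).1 (fun {T} => h.lift i (T := T))⟩
  · exact fun h => ⟨fun i => (X.rotate_comp_eq_zero_iff i).2 (h.zero (i + 1)),
      fun i T => (rotateSign_lift_iff _ _).2 (fun {T} => h.lift (i + 1) (T := T))⟩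

theorem IsExact.of_iso {X Y : Seq F n} (hX : X.IsExact) (φ : Hom X Y)
    (hφ : ∀ i, IsIso (φ.app i)) : Y.IsExact where
  zero i := by
    rw [← cancel_epi (φ.app i), ← Category.assoc, ← φ.comm, Category.assoc, ← Functor.map_comp,
      ← φ.comm, Functor.map_comp, ← Category.assoc, hX.zero, zero_comp, comp_zero]
  lift i T y hy := by
    obtain ⟨x, hx⟩ := hX.lift i (y ≫ inv (φ.app (i + 1))) (by
      rw [← cancel_mono ((carry F (i + 1)).map (φ.app (i + 1 + 1))), Category.assoc, φ.comm]
      simp [hy])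
    refine ⟨x ≫ φ.app i, ?_⟩
    rw [Category.assoc, ← φ.comm, ← Category.assoc, hx, ← Functor.map_comp]
    simp

theorem IsExact.of_retract {X Y : Seq F n} (hY : Y.IsExact) (φ : Hom X Y) (ψ : Hom Y X)
    (h : ∀ i, φ.app i ≫ ψ.app i = 𝟙 _) : X.IsExact where
  zero i := by
    rw [← Category.id_comp (X.map i), ← h, Category.assoc, Category.assoc,
      ← Category.assoc (ψ.app i), ← ψ.comm, Category.assoc, ← Functor.map_comp, ← ψ.comm,
      Functor.map_comp, ← Category.assoc (Y.map i), hY.zero, zero_comp, comp_zero]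
  lift i T y hy := by
    obtain ⟨x, hx⟩ := hY.lift i (y ≫ φ.app (i + 1)) (by
      rw [Category.assoc, ← φ.comm, ← Category.assoc, hy, zero_comp])
    refine ⟨x ≫ ψ.app i, ?_⟩
    rw [Category.assoc, ← ψ.comm, ← Category.assoc, hx, ← Functor.map_comp, Category.assoc, h,
      Category.comp_id]

theorem IsExact.exists_lift [F.IsEquivalence] [F.Additive] {X : Seq F n} (hX : X.IsExact)
    (i : Fin n) {T : C} (y : T ⟶ (carry F i).obj (X.obj (i + 1)))
    (hy : y ≫ (carry F i).map (X.map (i + 1)) = 0) : ∃ x : T ⟶ X.obj i, x ≫ X.map i = y := by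
  let e := (carry F i).objObjPreimageIso T
  obtain ⟨y', hy'⟩ := (carry F i).map_surjective (e.hom ≫ y)
  obtain ⟨x, hx⟩ := hX.lift i y' (by
    apply (carry F i).map_injective
    rw [Functor.map_comp, hy', Category.assoc, hy, comp_zero, Functor.map_zero])
  exact ⟨e.inv ≫ x, by rw [Category.assoc, hx, hy', e.inv_hom_id_assoc]⟩

/-- A sequence with an isomorphism `Xⱼ ⟶ Xⱼ₊₁` and zero objects otherwise is exact. -/
theorem isExact_of_isIso [F.Additive] (hn : 3 ≤ n) (X : Seq F n) (j : Fin n) [IsIso (X.map j)]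
    (hX : ∀ i, i ≠ j → i ≠ j + 1 → IsZero (X.obj i)) : X.IsExact where
  zero i := by
    by_cases hi : i = j
    · subst hi
      have := hX (i + 1 + 1) (fin_add_one_add_one_ne hn i) (fin_add_one_ne hn (i + 1))
      rw [((carry F (i + 1)).map_isZero this).eq_of_tgt (X.map (i + 1)) 0, Functor.map_zero,
        comp_zero]
    · by_cases hi' : i = j + 1
      · subst hi'
        have := hX (j + 1 + 1) (fin_add_one_add_one_ne hn j) (fin_add_one_ne hn (j + 1))
        rw [((carry F (j + 1)).map_isZero this).eq_of_tgt (X.map (j + 1)) 0, zero_comp]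
      · exact (hX i hi hi').eq_of_src _ _
  lift i T y hy := by
    by_cases hi : i = j
    · subst hi
      exact ⟨(carry F i).map y ≫ inv (X.map i), by simp⟩
    · refine ⟨0, ?_⟩
      have hy0 : y = 0 := by
        by_cases hi' : i + 1 = j
        · subst hi'
          rwa [← cancel_mono (X.map (i + 1)), zero_comp]
        · exact (hX (i + 1) hi' (by simpa using hi)).eq_of_tgt _ _
      rw [hy0, Functor.map_zero, zero_comp]

theorem isExact_trivial [F.Additive] [HasZeroObject C] (hn : 3 ≤ n) (A : C) :
    (trivial F hn A).IsExact :=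
  isExact_of_isIso hn _ 0 fun i h0 h1 => isZero_trivial_obj F hn A (by
    by_contra h
    interval_cases hi : (i : ℕ)
    · exact h0 (Fin.ext (by simp [hi]))
    · exact h1 (Fin.ext (by rw [hi, fin_val_zero_add_one hn])))

section

variable [HasBinaryBiproducts C]

/-- The inclusion of the first summand. -/
noncomputable def inlHom (X Y : Seq F n) : Hom X (X.directSum Y) where
  app _ := biprod.inl
  comm _ := (biprod.inl_desc _ _).symm

/-- The inclusion of the second summand. -/
noncomputable def inrHom (X Y : Seq F n) : Hom Y (X.directSum Y) where
  app _ := biprod.inr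
  comm _ := (biprod.inr_desc _ _).symm

/-- The projection to the first summand. -/
noncomputable def fstHom [F.Additive] (X Y : Seq F n) : Hom (X.directSum Y) X where
  app _ := biprod.fst
  comm i := by
    refine biprod.hom_ext' _ _ ?_ ?_ <;> simp [directSum, ← Functor.map_comp]

/-- The projection to the second summand. -/
noncomputable def sndHom [F.Additive] (X Y : Seq F n) : Hom (X.directSum Y) Y where
  app _ := biprod.snd
  comm i := by
    refine biprod.hom_ext' _ _ ?_ ?_ <;> simp [directSum, ← Functor.map_comp]


theorem directSum_hom_ext {X Y : Seq F n} {i : Fin n} {T : C}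
    {f g : (X.directSum Y).obj i ⟶ T}
    (h₁ : (inlHom X Y).app i ≫ f = (inlHom X Y).app i ≫ g)
    (h₂ : (inrHom X Y).app i ≫ f = (inrHom X Y).app i ≫ g) : f = g :=
  biprod.hom_ext' _ _ h₁ h₂

theorem isExact_directSum_iff [F.Additive] (X Y : Seq F n) :
    (X.directSum Y).IsExact ↔ X.IsExact ∧ Y.IsExact := by
  constructor
  · exact fun h => ⟨h.of_retract (inlHom X Y) (fstHom X Y) fun i => biprod.inl_fst,
      h.of_retract (inrHom X Y) (sndHom X Y) fun i => biprod.inr_snd⟩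
  · rintro ⟨hX, hY⟩
    refine ⟨fun i => directSum_hom_ext ?_ ?_, fun i T y hy => ?_⟩
    · rw [comp_zero, ← Category.assoc]
      rw [← (inlHom X Y).comm i, Category.assoc, ← Functor.map_comp,
        ← (inlHom X Y).comm (i + 1), Functor.map_comp, ← Category.assoc, hX.zero, zero_comp]
    · rw [comp_zero, ← Category.assoc]
      rw [← (inrHom X Y).comm i, Category.assoc, ← Functor.map_comp,
        ← (inrHom X Y).comm (i + 1), Functor.map_comp, ← Category.assoc, hY.zero, zero_comp]
    · obtain ⟨x₁, hx₁⟩ := hX.lift i (y ≫ (fstHom X Y).app (i + 1)) (by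
        rw [Category.assoc, ← (fstHom X Y).comm, ← Category.assoc, hy, zero_comp])
      obtain ⟨x₂, hx₂⟩ := hY.lift i (y ≫ (sndHom X Y).app (i + 1)) (by
        rw [Category.assoc, ← (sndHom X Y).comm, ← Category.assoc, hy, zero_comp])
      refine ⟨x₁ ≫ (inlHom X Y).app i + x₂ ≫ (inrHom X Y).app i, ?_⟩
      rw [Preadditive.add_comp, Category.assoc, Category.assoc, ← (inlHom X Y).comm,
        ← (inrHom X Y).comm, ← Category.assoc, ← Category.assoc, hx₁, hx₂, ← Functor.map_comp,
        ← Functor.map_comp, ← Functor.map_add, Category.assoc, Category.assoc,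
        ← Preadditive.comp_add]
      exact congrArg (carry F i).map ((y ≫= biprod.total).trans (Category.comp_id y))

/-! ### Exactness of mapping cones. -/

section Cone

variable {X Y : Seq F n} (φ : Hom X Y) (i : Fin n)

/-- The inclusion of the first summand of a term of the cone. -/
noncomputable def coneInl : (carry F i).obj (X.obj (i + 1)) ⟶ (cone φ).obj i := biprod.inl

/-- The inclusion of the second summand of a term of the cone. -/
noncomputable def coneInr : Y.obj i ⟶ (cone φ).obj i := biprod.inr

/-- The projection to the first summand of a term of the cone. -/
noncomputable def coneFst : (cone φ).obj i ⟶ (carry F i).obj (X.obj (i + 1)) := biprod.fst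

/-- The projection to the second summand of a term of the cone. -/
noncomputable def coneSnd : (cone φ).obj i ⟶ Y.obj i := biprod.snd

theorem cone_total : coneFst φ i ≫ coneInl φ i + coneSnd φ i ≫ coneInr φ i = 𝟙 _ :=
  biprod.total

variable {φ i} in
theorem cone_hom_ext {T : C} {f g : (cone φ).obj i ⟶ T}
    (h₁ : coneInl φ i ≫ f = coneInl φ i ≫ g) (h₂ : coneInr φ i ≫ f = coneInr φ i ≫ g) : f = g :=
  biprod.hom_ext' _ _ h₁ h₂

theorem coneInl_map : coneInl φ i ≫ (cone φ).map i = (carry F i).map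
    (-(X.map (i + 1) ≫ coneInl φ (i + 1)) + φ.app (i + 1) ≫ coneInr φ (i + 1)) := by
  refine (biprod.inl_desc _ _).trans (congrArg (carry F i).map ?_)
  rw [biprod.lift_eq, Preadditive.neg_comp]
  rfl

theorem coneInr_map :
    coneInr φ i ≫ (cone φ).map i = Y.map i ≫ (carry F i).map (coneInr φ (i + 1)) :=
  biprod.inr_desc _ _

theorem coneInl_fst : coneInl φ i ≫ coneFst φ i = 𝟙 _ := biprod.inl_fst

theorem coneInl_snd : coneInl φ i ≫ coneSnd φ i = 0 := biprod.inl_snd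

theorem coneInr_fst : coneInr φ i ≫ coneFst φ i = 0 := biprod.inr_fst

theorem coneInr_snd : coneInr φ i ≫ coneSnd φ i = 𝟙 _ := biprod.inr_snd

theorem cone_map_coneFst [F.Additive] : (cone φ).map i ≫ (carry F i).map (coneFst φ (i + 1)) =
    -(coneFst φ i ≫ (carry F i).map (X.map (i + 1))) := by
  refine cone_hom_ext ?_ ?_
  · rw [← Category.assoc, coneInl_map, ← Functor.map_comp, Preadditive.comp_neg,
      ← Category.assoc, coneInl_fst, Category.id_comp, ← Functor.map_neg]
    congr 1
    simp [coneInr_fst, coneInl_fst]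
  · rw [← Category.assoc, coneInr_map, Category.assoc, ← Functor.map_comp, Preadditive.comp_neg,
      ← Category.assoc (coneInr φ i), coneInr_fst, coneInr_fst]
    simp

theorem cone_map_coneSnd [F.Additive] : (cone φ).map i ≫ (carry F i).map (coneSnd φ (i + 1)) =
    coneFst φ i ≫ (carry F i).map (φ.app (i + 1)) + coneSnd φ i ≫ Y.map i := by
  refine cone_hom_ext ?_ ?_
  · rw [← Category.assoc, coneInl_map, ← Functor.map_comp, Preadditive.comp_add,
      ← Category.assoc, ← Category.assoc, coneInl_fst, coneInl_snd, Category.id_comp, zero_comp,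
      add_zero]
    congr 1
    simp [coneInr_snd, coneInl_snd]
  · rw [← Category.assoc, coneInr_map, Category.assoc, ← Functor.map_comp, Preadditive.comp_add,
      ← Category.assoc, ← Category.assoc, coneInr_fst, coneInr_snd, coneInr_snd]
    simp

end Cone

theorem IsExact.cone [F.IsEquivalence] [F.Additive] {X Y : Seq F n} (hX : X.IsExact)
    (hY : Y.IsExact) (φ : Hom X Y) : (cone φ).IsExact where
  zero i := by
    refine cone_hom_ext ?_ ?_
    · rw [← Category.assoc, coneInl_map, ← Functor.map_comp, comp_zero, Preadditive.add_comp,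
        Preadditive.neg_comp, Category.assoc, Category.assoc, coneInl_map, coneInr_map,
        Functor.map_add (F := carry F (i + 1)), Functor.map_neg, Preadditive.comp_add,
        Preadditive.comp_neg, Functor.map_comp, ← Category.assoc, hX.zero, zero_comp, neg_zero,
        zero_add, ← Category.assoc, ← φ.comm, Functor.map_comp, ← Category.assoc, neg_add_cancel,
        Functor.map_zero]
    · rw [← Category.assoc, coneInr_map, Category.assoc, ← Functor.map_comp, coneInr_map,
        Functor.map_comp, ← Category.assoc, hY.zero, zero_comp, comp_zero]
  lift i T y hy := by
    have h₁ : (y ≫ coneFst φ (i + 1)) ≫ (carry F (i + 1)).map (X.map (i + 1 + 1)) = 0 := by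
      rw [← neg_eq_zero, Category.assoc, ← Preadditive.comp_neg, ← cone_map_coneFst,
        ← Category.assoc, hy, zero_comp]
    have h₂ : (y ≫ coneFst φ (i + 1)) ≫ (carry F (i + 1)).map (φ.app (i + 1 + 1)) +
        (y ≫ coneSnd φ (i + 1)) ≫ Y.map (i + 1) = 0 := by
      rw [Category.assoc, Category.assoc, ← Preadditive.comp_add, ← cone_map_coneSnd,
        ← Category.assoc, hy, zero_comp]
    -- Lift the first coordinate of `y` to `x` through `X`. Correcting the second coordinate by `x
    -- φ` gives a cycle of `Y`, which lifts to `w`. The preimage is `(-x, w)`, with a sign because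
    -- the cone carries `-f`.
    obtain ⟨x, hx⟩ := hX.exists_lift (i + 1) _ h₁
    obtain ⟨w, hw⟩ := hY.lift i (x ≫ φ.app (i + 1) + y ≫ coneSnd φ (i + 1)) (by
      rw [Preadditive.add_comp, Category.assoc, ← φ.comm, ← Category.assoc, hx, h₂])
    refine ⟨(carry F i).map (-x) ≫ coneInl φ i + w ≫ coneInr φ i, ?_⟩
    rw [Preadditive.add_comp, Category.assoc, Category.assoc, coneInl_map, coneInr_map,
      ← Category.assoc w, hw, ← Functor.map_comp, ← Functor.map_comp, ← Functor.map_add]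
    congr 1
    rw [Preadditive.add_comp, Preadditive.neg_comp, Preadditive.comp_add, Preadditive.comp_neg,
      ← Category.assoc x, hx]
    conv_rhs => rw [← Category.comp_id y, ← cone_total]
    simp only [Preadditive.comp_add, Category.assoc]
    abel

end

end Seq

namespace Seq

/-! ### Completing morphisms by homotopies. -/

section Extension

variable {C : Type u} [Category.{v} C] [Preadditive C] {F : C ⥤ C} {n : ℕ} [NeZero n]

/-- The sum of two morphisms of sequences. -/
def Hom.add [F.Additive] {X Y : Seq F n} (φ ψ : Hom X Y) : Hom X Y where
  app i := φ.app i + ψ.app i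
  comm i := by
    rw [Functor.map_add, Preadditive.comp_add, Preadditive.add_comp, φ.comm, ψ.comm]

/-- The null-homotopic morphism given by `h : Xⱼ₊₁ ⟶ Yⱼ`. -/
theorem exists_hom_of_homotopy [F.IsEquivalence] [F.Additive] (hn : 3 ≤ n) {X Y : Seq F n}
    (hX : ∀ i, X.map i ≫ (carry F i).map (X.map (i + 1)) = 0)
    (hY : ∀ i, Y.map i ≫ (carry F i).map (Y.map (i + 1)) = 0)
    (j : Fin n) (h : (carry F j).obj (X.obj (j + 1)) ⟶ Y.obj j) :
    ∃ φ : Hom X Y, φ.app j = X.map j ≫ h ∧ (carry F j).map (φ.app (j + 1)) = h ≫ Y.map j ∧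
      ∀ i, i ≠ j → i ≠ j + 1 → φ.app i = 0 := by
  let p : X.obj (j + 1) ⟶ Y.obj (j + 1) := (carry F j).preimage (h ≫ Y.map j)
  have hp : (carry F j).map p = h ≫ Y.map j := (carry F j).map_preimage _
  let a : ∀ i, X.obj i ⟶ Y.obj i := Pi.single j (X.map j ≫ h)
  let b : ∀ i, X.obj i ⟶ Y.obj i := Pi.single (j + 1) p
  have ha : a j = X.map j ≫ h := Pi.single_eq_same ..
  have ha' : ∀ i, i ≠ j → a i = 0 := fun i hi => Pi.single_eq_of_ne hi _
  have hb : b (j + 1) = p := Pi.single_eq_same ..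
  have hb' : ∀ i, i ≠ j + 1 → b i = 0 := fun i hi => Pi.single_eq_of_ne hi _
  have hXa : ∀ i, X.map i ≫ (carry F i).map (a (i + 1)) = 0 := fun i => by
    by_cases hi : i + 1 = j
    · subst hi
      rw [ha, Functor.map_comp, ← Category.assoc, hX, zero_comp]
    · rw [ha' _ hi, Functor.map_zero, comp_zero]
  have hbY : ∀ i, b i ≫ Y.map i = 0 := fun i => by
    by_cases hi : i = j + 1
    · subst hi
      apply (carry F j).map_injective
      rw [hb, Functor.map_comp, hp, Category.assoc, hY, comp_zero, Functor.map_zero]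
    · rw [hb' _ hi, zero_comp]
  have hab : ∀ i, X.map i ≫ (carry F i).map (b (i + 1)) = a i ≫ Y.map i := fun i => by
    by_cases hi : i = j
    · subst hi
      rw [ha, hb, hp, Category.assoc]
    · rw [ha' _ hi, hb' _ (by simpa using hi), Functor.map_zero, comp_zero, zero_comp]
  refine ⟨⟨fun i => a i + b i, fun i => ?_⟩, ?_, ?_, fun i hi hi' => ?_⟩
  · rw [Functor.map_add, Preadditive.comp_add, Preadditive.add_comp, hXa, hbY, hab, zero_add,
      add_zero]
  · change a j + b j = _
    rw [ha, hb' _ (fin_add_one_ne hn j).symm, add_zero]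
  · change (carry F j).map (a (j + 1) + b (j + 1)) = _
    rw [hb, ha' _ (fin_add_one_ne hn j), zero_add, hp]
  · change a i + b i = 0
    rw [ha' _ hi, hb' _ hi', add_zero]

/-- In a semisimple category, exact sequences are exact with respect to morphisms to an object. -/
theorem IsExact.exists_desc [F.Additive] (hC : IsSemisimple C)
    {X : Seq F n} (hX : X.IsExact) (i : Fin n) {W : C} (z : (carry F i).obj (X.obj (i + 1)) ⟶ W)
    (hz : X.map i ≫ z = 0) :
    ∃ w : (carry F i).obj ((carry F (i + 1)).obj (X.obj (i + 1 + 1))) ⟶ W,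
      (carry F i).map (X.map (i + 1)) ≫ w = z := by
  obtain ⟨t, ht⟩ := hC.exists_regular (X.map (i + 1))
  -- With `d = X.map (i + 1)`, the defect `1 - d t` is killed by `d`, so up to `carry F i` it
  -- factors through `X.map i`, after which `z` vanishes. Thus `z` equals `d t z`.
  obtain ⟨x, hx⟩ := hX.lift i (𝟙 _ - X.map (i + 1) ≫ t) (by simp [ht])
  refine ⟨(carry F i).map t ≫ z, ?_⟩
  have := hx =≫ z
  rw [Category.assoc, hz, comp_zero, Functor.map_sub, CategoryTheory.Functor.map_id,
    Preadditive.sub_comp, Category.id_comp, Functor.map_comp, Category.assoc] at this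
  exact (sub_eq_zero.1 this.symm).symm

theorem IsExact.exists_hom [F.IsEquivalence] [F.Additive] (hn : 3 ≤ n) (hC : IsSemisimple C)
    {X Y : Seq F n} (hX : X.IsExact) (hY : Y.IsExact) (j : Fin n)
    (a : X.obj (j + 1) ⟶ Y.obj (j + 1)) (b : X.obj (j + 1 + 1) ⟶ Y.obj (j + 1 + 1))
    (hab : X.map (j + 1) ≫ (carry F (j + 1)).map b = a ≫ Y.map (j + 1)) :
    ∃ φ : Hom X Y, φ.app (j + 1) = a ∧ φ.app (j + 1 + 1) = b := by
  obtain ⟨t, ht⟩ := hC.exists_regular (X.map (j + 1))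
  -- With `f`, `g` the morphisms at `j + 1`, split `a = (a - f t a) + f t a` and `b = t a g + (b - t
  -- a g)`. The middle homotopy `t a` yields `f t a` and `t a g`. The remainders are killed by `g`
  -- and `f` respectively, so exactness supplies the outer homotopies `x` and `w`.
  obtain ⟨x, hx⟩ := hY.lift j (a - X.map (j + 1) ≫ t ≫ a) (by
    rw [Preadditive.sub_comp, ← hab, Category.assoc, Category.assoc, ← hab, ← Category.assoc t,
      ← Category.assoc (X.map (j + 1)), ← Category.assoc,
      Category.assoc _ t, ht, sub_self])
  obtain ⟨w, hw⟩ := hX.exists_desc hC (j + 1)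
    ((carry F (j + 1)).map b - t ≫ a ≫ Y.map (j + 1)) (by
      rw [← hab, Preadditive.comp_sub, ← Category.assoc t, ← Category.assoc (X.map (j + 1)),
        ← Category.assoc, Category.assoc _ t, ht, sub_self])
  obtain ⟨w, rfl⟩ := (carry F (j + 1)).map_surjective w
  rw [← Functor.map_comp] at hw
  obtain ⟨φ, -, hφ, hφ'⟩ := exists_hom_of_homotopy hn hX.zero hY.zero j x
  obtain ⟨ψ, hψ, hψ', -⟩ := exists_hom_of_homotopy hn hX.zero hY.zero (j + 1) (t ≫ a)
  obtain ⟨χ, hχ, -, hχ'⟩ := exists_hom_of_homotopy hn hX.zero hY.zero (j + 1 + 1) w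
  refine ⟨(φ.add ψ).add χ, ?_, ?_⟩
  · change φ.app (j + 1) + ψ.app (j + 1) + χ.app (j + 1) = a
    rw [hψ, hχ' _ (fin_add_one_ne hn _).symm (fin_add_one_add_one_ne hn _).symm, add_zero,
      (carry F j).map_injective (hφ.trans hx)]
    abel
  · change φ.app (j + 1 + 1) + ψ.app (j + 1 + 1) + χ.app (j + 1 + 1) = b
    apply (carry F (j + 1)).map_injective
    rw [hφ' _ (fin_add_one_add_one_ne hn _) (fin_add_one_ne hn _), zero_add, Functor.map_add, hψ',
      hχ, hw, Category.assoc]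
    abel

end Extension

/-! ### Contractible sequences and the realization of morphisms. -/

section Disk

variable {C : Type u} [Category.{v} C] [Preadditive C] [HasZeroObject C] (F : C ⥤ C) {n : ℕ}
  [NeZero n]

/-- The sequence with the identity of `Σ A` or `A` as its `j`-th morphism, and zero objects
otherwise. -/
noncomputable def disk (hn : 3 ≤ n) (j : Fin n) (A : C) : Seq F n where
  obj i := if i = j then (carry F j).obj A else if i = j + 1 then A else 0
  map i := if h : i = j then eqToHom (by
    subst h
    rw [if_pos rfl, if_neg (fin_add_one_ne hn i), if_pos rfl]) else 0

variable (hn : 3 ≤ n) (j : Fin n) (A : C)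

theorem disk_obj_self : (disk F hn j A).obj j = (carry F j).obj A := if_pos rfl

theorem disk_obj_add_one : (disk F hn j A).obj (j + 1) = A :=
  (if_neg (fin_add_one_ne hn j)).trans (if_pos rfl)

variable {j} in
theorem isZero_disk_obj {i : Fin n} (h : i ≠ j) (h' : i ≠ j + 1) :
    IsZero ((disk F hn j A).obj i) := by
  dsimp only [disk]
  rw [if_neg h, if_neg h']
  exact isZero_zero C

theorem disk_map_self : (disk F hn j A).map j = eqToHom (by
    rw [disk_obj_self, disk_obj_add_one]) := dif_pos rfl

theorem isExact_disk [F.Additive] : (disk F hn j A).IsExact := by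
  have : IsIso ((disk F hn j A).map j) := by rw [disk_map_self]; infer_instance
  exact isExact_of_isIso hn _ j fun i h h' => isZero_disk_obj F hn A h h'

end Disk

end Seq

namespace Seq

section ExistsMem

/-- (N1)(c) asks for an equality of arrows, so the first two objects of a sequence must be replaced
by `A` and `B` on the nose. -/
theorem exists_objs_of_iso {C : Type u} [Category.{v} C] {ι : Type*} (X : ι → C) {i j : ι}
    (hij : i ≠ j) {A B : C} (a : A ≅ X i) (b : B ≅ X j) :
    ∃ (Z : ι → C) (e : ∀ k, Z k ≅ X k) (hA : Z i = A) (hB : Z j = B),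
      (e i).hom = eqToHom hA ≫ a.hom ∧ (e j).hom = eqToHom hB ≫ b.hom := by
  classical
  refine ⟨fun k => if k = i then A else if k = j then B else X k, fun k =>
    if h : k = i then eqToIso (if_pos h) ≪≫ a ≪≫ eqToIso (by rw [h])
    else if h' : k = j then
      eqToIso ((if_neg h).trans (if_pos h')) ≪≫ b ≪≫ eqToIso (by rw [h'])
    else eqToIso ((if_neg h).trans (if_neg h')), if_pos rfl,
    (if_neg hij.symm).trans (if_pos rfl), ?_, ?_⟩
  · simp
  · simp [hij.symm]

theorem mk_comp_map_inv {C : Type u} [Category.{v} C] {G : C ⥤ C} (hG : 𝟭 C = G) {A B B' : C}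
    (f : A ⟶ B) (b : B ≅ B') :
    Arrow.mk ((f ≫ b.hom ≫ (eqToHom hG).app B') ≫ G.map b.inv) = Arrow.mk f := by
  subst hG
  simp

variable {C : Type u} [Category.{v} C] [Preadditive C] {F : C ⥤ C} {n : ℕ} [NeZero n]

theorem IsExact.exists_map_zero_eq (hn : 3 ≤ n) {X : Seq F n} (hX : X.IsExact)
    (h0 : 𝟭 C = carry F (0 : Fin n))
    {A B : C} (f : A ⟶ B) (a : A ≅ X.obj 0) (b : B ≅ X.obj (0 + 1))
    (h : a.hom ≫ X.map 0 = f ≫ b.hom ≫ (eqToHom h0).app _) :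
    ∃ Y : Seq F n, Y.IsExact ∧ Arrow.mk (Y.map 0) = Arrow.mk f := by
  obtain ⟨Z, e, rfl, rfl, ha, hb⟩ := exists_objs_of_iso X.obj (fin_add_one_ne hn 0).symm a b
  let Y : Seq F n :=
    { obj := Z
      map := fun i => (e i).hom ≫ X.map i ≫ (carry F i).map (e (i + 1)).inv }
  refine ⟨Y, hX.of_iso (Y := Y) ⟨fun i => (e i).inv, fun i => ?_⟩ (fun i => inferInstance), ?_⟩
  · simp [Y]
  · have hb' : (e (0 + 1)).inv = b.inv := by
      rw [Iso.inv_eq_inv, hb]; simp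
    have : Y.map 0 = (f ≫ b.hom ≫ (eqToHom h0).app _) ≫ (carry F 0).map b.inv := by
      rw [← h, ← hb']
      simp [Y, ha]
    rw [this]
    exact mk_comp_map_inv h0 f b

variable [HasBinaryBiproducts C]

/-- The biproduct decomposition given by complementary split epimorphisms. -/
noncomputable def isoBiprod {A Z K : C} (g : A ⟶ Z) (s : Z ⟶ A) (k : K ⟶ A) (p : A ⟶ K)
    (hs : s ≫ g = 𝟙 Z) (hkp : k ≫ p = 𝟙 K) (hkg : k ≫ g = 0) (hsp : s ≫ p = 0)
    (h : p ≫ k + g ≫ s = 𝟙 A) : A ≅ Z ⊞ K where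
  hom := biprod.lift g p
  inv := biprod.desc s k
  hom_inv_id := by rw [biprod.lift_desc, add_comm, h]
  inv_hom_id := by ext <;> simp [*]

theorem exists_isExact_map_zero_eq [HasZeroObject C] [F.Additive] (hn : 3 ≤ n)
    (hC : IsSemisimple C) {A B : C} (f : A ⟶ B) :
    ∃ Y : Seq F n, Y.IsExact ∧ Arrow.mk (Y.map 0) = Arrow.mk f := by
  have := hC.isIdempotentComplete
  obtain ⟨Z, g, h, hg, hh, rfl⟩ := hC f
  obtain ⟨K, k, p, hkp, hkg, hsp, hpk⟩ := exists_kernel_splitting g (section_ g) (by simp)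
  obtain ⟨L, c, q, hcq, hcr, hhq, hqc⟩ := exists_kernel_splitting (retraction h) h (by simp)
  obtain ⟨j, hj⟩ : ∃ j : Fin n, j + 1 = 0 := ⟨-1, by simp⟩
  have h0 : 𝟭 C = carry F (0 : Fin n) := (carry_of_ne F (by rw [Fin.val_zero]; omega)).symm
  have h1 : carry F (0 + 1 : Fin n) = 𝟭 C :=
    carry_of_ne F (by rw [fin_val_zero_add_one hn]; omega)
  have h01 : (0 : Fin n) ≠ 0 + 1 := (fin_add_one_ne hn 0).symm
  have h02 : (0 : Fin n) ≠ 0 + 1 + 1 := (fin_add_one_add_one_ne hn 0).symm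
  -- As `A ≅ Z ⊞ K` and `B ≅ Z ⊞ L`, the morphism is the identity of `Z` plus `K ⟶ 0` plus `0 ⟶ L`.
  -- The three disks supply these summands; `V` sits at the last index `j`, so that `K` appears at
  -- index `0`.
  let U := disk F hn 0 Z
  let V := disk F hn j K
  let W := disk F hn (0 + 1) L
  have hV : IsZero (V.obj (0 + 1)) := isZero_disk_obj F hn K
    (fun hj' => h02 (by rw [hj', hj])) (by rw [hj]; exact h01.symm)
  have hW : IsZero (W.obj 0) := isZero_disk_obj F hn L h01 h02
  let α : Z ≅ U.obj 0 := (eqToIso h0).app Z ≪≫ eqToIso (disk_obj_self F hn 0 Z).symm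
  let β : Z ≅ U.obj (0 + 1) := eqToIso (disk_obj_add_one F hn 0 Z).symm
  let κ : K ≅ V.obj 0 := eqToIso (by rw [← hj]; exact (disk_obj_add_one F hn j K).symm)
  let γ : L ≅ W.obj (0 + 1) := (eqToIso h1.symm).app L ≪≫
    eqToIso (disk_obj_self F hn (0 + 1) L).symm
  have hU : α.hom ≫ U.map 0 = β.hom ≫ (eqToHom h0).app (U.obj (0 + 1)) := by
    rw [show U.map 0 = _ from disk_map_self F hn 0 Z]
    simp [α, β, eqToHom_app]
  have hV0 : V.map 0 = 0 := ((carry F (0 : Fin n)).map_isZero hV).eq_of_tgt _ _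
  let D := U.directSum V
  let a : A ≅ (D.directSum W).obj 0 :=
    isoBiprod g (section_ g) k p (by simp) hkp hkg hsp hpk ≪≫ biprod.mapIso α κ ≪≫
      isoBiprodZero hW
  let b : B ≅ (D.directSum W).obj (0 + 1) :=
    isoBiprod (retraction h) h c q (by simp) hcq hcr hhq hqc ≪≫
      biprod.mapIso (β ≪≫ isoBiprodZero hV) γ
  have ha : a.hom = (g ≫ α.hom ≫ (inlHom U V).app 0 + p ≫ κ.hom ≫ (inrHom U V).app 0) ≫
      (inlHom D W).app 0 := by
    have : biprod.lift g p ≫ biprod.map α.hom κ.hom =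
        g ≫ α.hom ≫ biprod.inl + p ≫ κ.hom ≫ biprod.inr := by
      rw [biprod.lift_eq]; simp
    exact (Category.assoc _ _ _).symm.trans (this =≫ (inlHom D W).app 0)
  have hb : h ≫ b.hom = β.hom ≫ (inlHom U V).app (0 + 1) ≫ (inlHom D W).app (0 + 1) := by
    have : h ≫ biprod.lift (retraction h) q ≫
        biprod.map (β.hom ≫ (isoBiprodZero hV).hom) γ.hom =
        β.hom ≫ (isoBiprodZero hV).hom ≫ biprod.inl := by
      rw [biprod.lift_eq]
      simp [reassoc_of% hhq]
    exact this
  refine IsExact.exists_map_zero_eq hn (X := D.directSum W) ?_ h0 _ a b ?_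
  · exact (isExact_directSum_iff _ _).2 ⟨(isExact_directSum_iff _ _).2
      ⟨isExact_disk .., isExact_disk ..⟩, isExact_disk ..⟩
  · rw [ha, Category.assoc, ← (inlHom D W).comm, Preadditive.add_comp]
    simp only [Category.assoc]
    rw [← reassoc_of% (inlHom U V).comm 0, ← reassoc_of% (inrHom U V).comm 0, hV0, zero_comp,
      comp_zero, comp_zero, add_zero, reassoc_of% hb]
    rw [reassoc_of% hU, ← NatTrans.naturality_assoc, ← NatTrans.naturality]
    rfl

end ExistsMem

end Seq

/-! ### The two implications and the conclusion. -/

theorem IsSemisimple.admitsNAngulation {C : Type u} [Category.{v} C] [Preadditive C]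
    [HasZeroObject C] [HasBinaryBiproducts C] (hC : IsSemisimple C) {n : ℕ} [NeZero n]
    (hn : 3 ≤ n) (F : C ⥤ C) [F.IsEquivalence] : AdmitsNAngulation F n := by
  have := additive_of_isEquivalence F
  have hom : ∀ {X Y : Seq F n}, X.IsExact → Y.IsExact →
      ∀ (a : X.obj 0 ⟶ Y.obj 0) (b : X.obj (0 + 1) ⟶ Y.obj (0 + 1)),
        X.map 0 ≫ (carry F 0).map b = a ≫ Y.map 0 →
        ∃ φ : Seq.Hom X Y, φ.app 0 = a ∧ φ.app (0 + 1) = b := by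
    intro X Y hX hY
    -- `IsExact.exists_hom` also uses the index before the given pair, which here is the last one.
    obtain ⟨j, hj⟩ : ∃ j : Fin n, j + 1 = 0 := ⟨-1, by simp⟩
    rw [← hj]
    exact hX.exists_hom hn hC hY j
  refine ⟨{X | X.IsExact}, ?_⟩
  exact
    { three_le := hn
      mem_of_iso := fun φ hφ hX => hX.of_iso φ hφ
      directSum_mem := fun hX hY => (Seq.isExact_directSum_iff _ _).2 ⟨hX, hY⟩
      mem_of_directSum_mem := fun h => (Seq.isExact_directSum_iff _ _).1 h
      trivial_mem := Seq.isExact_trivial hn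
      exists_mem := Seq.exists_isExact_map_zero_eq hn hC
      rotate_mem_iff := fun X => X.isExact_rotate_iff.symm
      exists_hom := hom
      exists_cone_mem := fun hX hY a b hab => by
        obtain ⟨φ, ha, hb⟩ := hom hX hY a b hab
        exact ⟨φ, ha, hb, hX.cone hY φ⟩ }

theorem AdmitsNAngulation.isSemisimple {C : Type u} [Category.{v} C] [Preadditive C]
    [HasZeroObject C] [HasBinaryBiproducts C] {m n : ℕ} [NeZero n] {F : C ⥤ C}
    (hF : IsAutomorphism F) (hn : AdmitsNAngulation F n) (hm : IsMAbelian C m) :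
    IsSemisimple C := by
  have := hF.isEquivalence
  have := additive_of_isEquivalence F
  obtain ⟨Θ, hΘ⟩ := hn
  intro X Y f
  exact hm.isSemisimple (fun f hf => hΘ.isSplitMono_of_mono f hf) f

end NAngulated

theorem corollary5p4 {C : Type u} [Category.{v} C] [Preadditive C] [HasZeroObject C]
    [HasBinaryBiproducts C] (m n : ℕ) [NeZero n] (hm : 1 ≤ m) (hn : 3 ≤ n) :
    ((NAngulated.IsNAngulatedCategory C n ∧ NAngulated.IsMAbelian C m) ↔
      NAngulated.IsSemisimple C) ∧
    ∀ F : C ⥤ C, NAngulated.IsAutomorphism F →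
      ((NAngulated.AdmitsNAngulation F n ∧ NAngulated.IsMAbelian C m) ↔
        NAngulated.IsSemisimple C) := by
  have key : ∀ F : C ⥤ C, NAngulated.IsAutomorphism F →
      ((NAngulated.AdmitsNAngulation F n ∧ NAngulated.IsMAbelian C m) ↔
        NAngulated.IsSemisimple C) := fun F hF => by
    have := hF.isEquivalence
    exact ⟨fun h => h.1.isSemisimple hF h.2,
      fun h => ⟨NAngulated.IsSemisimple.admitsNAngulation h hn F,
        NAngulated.IsSemisimple.isMAbelian h hm⟩⟩
  have hid : NAngulated.IsAutomorphism (𝟭 C) := ⟨𝟭 C, rfl, rfl⟩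
  refine ⟨⟨?_, fun h => ?_⟩, key⟩
  · rintro ⟨⟨F, hF, h⟩, h'⟩
    exact (key F hF).1 ⟨h, h'⟩
  · exact ⟨⟨𝟭 C, hid, ((key _ hid).2 h).1⟩, ((key _ hid).2 h).2⟩
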